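/- For $n\ge 0$ let $\mathbb B^n=\{z\in\mathbb C^n : |z|<1\}$ be the unit ball, equipped with its Kähler–Einstein metric normalized so that complex lines through the origin have Gaussian curvature $-2$, that is, with the Riemannian metric $$g_{\mathbb B^n}=2\,\mathrm{Re}\sum_{j,k=1}^n\Big(-\frac{\partial^2\log(1-|z|^2)}{\partial z_j\,\partial\bar z_k}\Big)\,dz_j\otimes d\bar z_k .$$ Let $f\colon(\mathbb B^n,g_{\mathbb B^n})\to(\mathbb B^m,g_{\mathbb B^m})$ be a $C^2$-smooth totally geodesic isometric embedding; that is, $f$ is a topological embedding with $f^*g_{\mathbb B^m}=g_{\mathbb B^n}$ and $D\,df=0$, where $D$ is the connection on $T^*\mathbb B^n\otimes f^*T\mathbb B^m$ induced by the Levi-Civita connections. Then $n\le m$, and there are holomorphic automorphisms $\varphi$ of $\mathbb B^n$ and $\psi$ of $\mathbb B^m$ such that either $$\psi\circ f\circ\varphi(z_1,\dots,z_n)=(z_1,\dots,z_n,0,\dots,0)\quad\text{for all } z\in\mathbb B^n,$$ or $$\psi\circ f\circ\varphi(z_1,\dots,z_n)=(\bar z_1,\dots,\bar z_n,0,\dots,0)\quad\text{for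 all } z\in\mathbb B^n.$$ -/

import Mathlib

namespace BallGeometry

open scoped ComplexConjugate

section RiemannianChart

variable {E F : Type*} [NormedAddCommGroup E] [NormedSpace ℝ E]
  [NormedAddCommGroup F] [NormedSpace ℝ F]

/-- Christoffel symbols of the first kind (Koszul formula for constant vector fields) of a
Riemannian metric `g` on an open subset of the vector space `E`:
`½ (∂_u g(v,w) + ∂_v g(u,w) - ∂_w g(u,v))` at the point `p`. -/
noncomputable def christoffelFirst (g : E → E → E → ℝ) (p u v w : E) : ℝ :=
  (1 / 2) * (fderiv ℝ (fun q => g q v w) p u + fderiv ℝ (fun q => g q u w) p v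
    - fderiv ℝ (fun q => g q u v) p w)

/-- Christoffel symbols of the second kind, i.e. the Levi-Civita derivative at `p` of the constant
vector field `v` in the direction `u`: the vector `c` with
`g_p(c, w) = christoffelFirst g p u v w` for all `w` (unique, as `g_p` is nondegenerate). -/
noncomputable def christoffel (g : E → E → E → ℝ) (p u v : E) : E :=
  Classical.epsilon fun c : E => ∀ w, g p c w = christoffelFirst g p u v w

/-- The second fundamental form `(D df)(u, v)` at `p` of a map `f` between open subsets of `E` and
`F` with Riemannian metrics `g` and `h`, where `D` is induced by the Levi-Civita connections. -/
noncomputable def secondFundamentalForm (g : E → E → E → ℝ) (h : F → F → F → ℝ)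
    (f : E → F) (p u v : E) : F :=
  fderiv ℝ (fderiv ℝ f) p u v - fderiv ℝ f p (christoffel g p u v)
    + christoffel h (f p) (fderiv ℝ f p u) (fderiv ℝ f p v)

/-- `f : (U, g) → (V, h)` is a `C²` totally geodesic isometric embedding, `U` and `V` being open
sets; only the values of `f` on `U` matter. -/
structure IsTotallyGeodesicIsometricEmbedding (U : Set E) (V : Set F)
    (g : E → E → E → ℝ) (h : F → F → F → ℝ) (f : E → F) : Prop where
  mapsTo : Set.MapsTo f U V
  contDiffOn : ContDiffOn ℝ 2 f U
  isEmbedding : Topology.IsEmbedding (U.domRestrict f)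
  isometric : ∀ p ∈ U, ∀ u v : E, h (f p) (fderiv ℝ f p u) (fderiv ℝ f p v) = g p u v
  totallyGeodesic : ∀ p ∈ U, ∀ u v : E, secondFundamentalForm g h f p u v = 0

end RiemannianChart

/-- The open Euclidean unit ball of `ℂⁿ`. -/
def unitBall (n : ℕ) : Set (EuclideanSpace ℂ (Fin n)) := Metric.ball 0 1

/-- The Kähler-Einstein (Bergman) metric of the unit ball, with Kähler form given by the potential
`-log (1 - |z|²)`, as a Riemannian metric: `g = 2 Re ∑ g_{jk̄} dz_j ⊗ dz̄_k` with
`g_{jk̄} = - ∂²/∂z_j∂z̄_k log (1 - |z|²) = δ_{jk} / (1 - |z|²) + z̄_j z_k / (1 - |z|²)²`.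
For `n = 1` it is `2 |dz|² / (1 - |z|²)²`, of Gaussian curvature `-2`. -/
noncomputable def ballMetric (n : ℕ) (z u v : EuclideanSpace ℂ (Fin n)) : ℝ :=
  2 * ((inner ℂ u v).re / (1 - ‖z‖ ^ 2)
    + (inner ℂ u z * inner ℂ z v).re / (1 - ‖z‖ ^ 2) ^ 2)

/-- `φ` restricts to a biholomorphic map of the unit ball onto itself. -/
def IsBallAut {n : ℕ} (φ : EuclideanSpace ℂ (Fin n) → EuclideanSpace ℂ (Fin n)) : Prop :=
  DifferentiableOn ℂ φ (unitBall n) ∧ Set.MapsTo φ (unitBall n) (unitBall n) ∧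
    ∃ ψ : EuclideanSpace ℂ (Fin n) → EuclideanSpace ℂ (Fin n),
      DifferentiableOn ℂ ψ (unitBall n) ∧ Set.MapsTo ψ (unitBall n) (unitBall n) ∧
        Set.InvOn ψ φ (unitBall n) (unitBall n)

/-- `(z₁, …, zₙ) ↦ (z₁, …, zₙ, 0, …, 0)` (meant for `n ≤ m`). -/
noncomputable def padZero {n : ℕ} (m : ℕ) (z : EuclideanSpace ℂ (Fin n)) :
    EuclideanSpace ℂ (Fin m) :=
  WithLp.toLp 2 fun j => if hj : j.val < n then z ⟨j.val, hj⟩ else 0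

/-- `(z₁, …, zₙ) ↦ (z̄₁, …, z̄ₙ)`. -/
noncomputable def conjVec {n : ℕ} (z : EuclideanSpace ℂ (Fin n)) : EuclideanSpace ℂ (Fin n) :=
  WithLp.toLp 2 fun j => conj (z j)

end BallGeometry

/-! In the ball the Christoffel term at velocity `u` is a complex multiple of `u`. For a ray `t •
v`, total geodesy therefore makes the acceleration of `x t = f (t • v)` a multiple `-2q` of its
velocity. Constancy of the metric speed turns into the Riccati equation `q' = -q²`, whose solution
shows that `(1 + α t) • x t` is affine in `t` (`geodesic_apply_one`). The involution exchanging `0`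
and `f 0` is projective linear, and it carries the endpoint `f v` to a real-linear function of `v`
(`ballInvolution_apply`).

Hence `f`, followed by this involution, is a real-linear map `B` on the ball. The involution is an
isometry (`ballMetric_ballInvolution`), so `B` is one too. Comparing metrics at `0` gives `‖B u‖ =
‖u‖`; comparing them at `z` gives `|⟪B z, B u⟫| = |⟪z, u⟫|`. Equality in Cauchy–Schwarz forces `B (i
u) = ± i B u`, with one sign for all `u` (`forall_map_I_smul_or`). So `B` is a complex linear
isometry, possibly after conjugation, and a unitary map of the target brings it to the standard
inclusion. -/

namespace BallGeometry

open scoped ComplexConjugate InnerProductSpace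

/-! ### Involutive automorphisms of the ball, in homogeneous coordinates. -/

section Defect

variable {E : Type*} [NormedAddCommGroup E]

/-- The number `√(1 - |a|²)`, as a complex number. -/
noncomputable def defect (a : E) : ℂ := (√(1 - ‖a‖ ^ 2) : ℝ)

lemma defect_ne_zero {a : E} (ha : ‖a‖ < 1) : defect a ≠ 0 := by
  have h : 0 < 1 - ‖a‖ ^ 2 := by nlinarith [norm_nonneg a]
  simpa [defect] using (Real.sqrt_pos.2 h).ne'

lemma one_add_defect_ne_zero (a : E) : 1 + defect a ≠ 0 := by
  have h : (0 : ℝ) < 1 + √(1 - ‖a‖ ^ 2) := by positivity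
  rw [defect]
  exact_mod_cast h.ne'

lemma conj_defect (a : E) : conj (defect a) = defect a := Complex.conj_ofReal _

end Defect

section Involution

variable {E : Type*} [NormedAddCommGroup E] [InnerProductSpace ℂ E]

/-- The denominator, in homogeneous coordinates, of the involution exchanging `0` and `a`. -/
noncomputable def liftDen (a : E) (c : ℂ) (x : E) : ℂ := c - ⟪a, x⟫_ℂ

/-- The numerator, in homogeneous coordinates, of the involution exchanging `0` and `a`. -/
noncomputable def liftNum (a : E) (c : ℂ) (x : E) : E :=
  (c - ⟪a, x⟫_ℂ / (1 + defect a)) • a - defect a • x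

/-- The holomorphic involution of the unit ball exchanging `0` and `a`. -/
noncomputable def ballInvolution (a z : E) : E := (liftDen a 1 z)⁻¹ • liftNum a 1 z

lemma defect_sq {a : E} (ha : ‖a‖ < 1) : defect a ^ 2 = 1 - ⟪a, a⟫_ℂ := by
  have h : 0 ≤ 1 - ‖a‖ ^ 2 := by nlinarith [norm_nonneg a]
  rw [inner_self_eq_norm_sq_to_K, defect, ← Complex.ofReal_pow, Real.sq_sqrt h]
  push_cast
  rfl

lemma one_sub_inner_ne_zero {a z : E} (ha : ‖a‖ < 1) (hz : ‖z‖ < 1) : 1 - ⟪a, z⟫_ℂ ≠ 0 := by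
  intro h
  have h1 : ‖⟪a, z⟫_ℂ‖ = 1 := by rw [← sub_eq_zero.1 h]; simp
  have h2 := norm_inner_le_norm (𝕜 := ℂ) a z
  nlinarith [norm_nonneg a, norm_nonneg z]

/-- The lift of the involution multiplies the Hermitian form of signature `(1, n)` by a
constant. -/
lemma liftDen_mul_sub_inner_liftNum {a : E} (ha : ‖a‖ < 1) (c d : ℂ) (x y : E) :
    conj (liftDen a c x) * liftDen a d y - ⟪liftNum a c x, liftNum a d y⟫_ℂ
      = defect a ^ 2 * (conj c * d - ⟪x, y⟫_ℂ) := by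
  have h1 := one_add_defect_ne_zero a
  have h2 : ⟪a, a⟫_ℂ = 1 - defect a ^ 2 := by rw [defect_sq ha]; ring
  simp only [liftDen, liftNum, inner_sub_left, inner_sub_right, inner_smul_left,
    inner_smul_right, map_sub, map_div₀, map_add, map_one, conj_defect, inner_conj_symm, h2]
  field_simp
  ring

lemma liftDen_smul_ballInvolution {a z : E} (ha : ‖a‖ < 1) (hz : ‖z‖ < 1) :
    liftDen a 1 z • ballInvolution a z = liftNum a 1 z :=
  smul_inv_smul₀ (one_sub_inner_ne_zero ha hz) _

lemma inner_self_ballInvolution {a z : E} (ha : ‖a‖ < 1) (hz : ‖z‖ < 1) :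
    conj (liftDen a 1 z) * liftDen a 1 z *
        (1 - ⟪ballInvolution a z, ballInvolution a z⟫_ℂ)
      = defect a ^ 2 * (1 - ⟪z, z⟫_ℂ) := by
  have h := liftDen_mul_sub_inner_liftNum ha 1 1 z z
  rw [← liftDen_smul_ballInvolution ha hz, inner_smul_left, inner_smul_right, map_one] at h
  linear_combination h

lemma norm_sq_ballInvolution {a z : E} (ha : ‖a‖ < 1) (hz : ‖z‖ < 1) :
    ‖liftDen a 1 z‖ ^ 2 * (1 - ‖ballInvolution a z‖ ^ 2) = (1 - ‖a‖ ^ 2) * (1 - ‖z‖ ^ 2) := by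
  have h := inner_self_ballInvolution ha hz
  rw [defect_sq ha, Complex.conj_mul', inner_self_eq_norm_sq_to_K, inner_self_eq_norm_sq_to_K,
    inner_self_eq_norm_sq_to_K] at h
  apply Complex.ofReal_injective
  push_cast
  exact h

lemma norm_ballInvolution_lt {a z : E} (ha : ‖a‖ < 1) (hz : ‖z‖ < 1) :
    ‖ballInvolution a z‖ < 1 := by
  have h := norm_sq_ballInvolution ha hz
  have h1 : 0 < ‖liftDen a 1 z‖ ^ 2 := by
    have := norm_pos_iff.2 (one_sub_inner_ne_zero ha hz)
    unfold liftDen; positivity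
  have h2 : 0 < (1 - ‖a‖ ^ 2) * (1 - ‖z‖ ^ 2) :=
    mul_pos (by nlinarith [norm_nonneg a]) (by nlinarith [norm_nonneg z])
  have h3 : 0 < 1 - ‖ballInvolution a z‖ ^ 2 := by
    rw [← h] at h2
    exact pos_of_mul_pos_right h2 h1.le
  nlinarith [norm_nonneg (ballInvolution a z)]

lemma ballInvolution_ballInvolution {a z : E} (ha : ‖a‖ < 1) (hz : ‖z‖ < 1) :
    ballInvolution a (ballInvolution a z) = z := by
  have hs := one_add_defect_ne_zero a
  have hs0 := defect_ne_zero ha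
  have hl : 1 - ⟪a, z⟫_ℂ ≠ 0 := one_sub_inner_ne_zero ha hz
  have h2 : ⟪a, a⟫_ℂ = 1 - defect a ^ 2 := by rw [defect_sq ha]; ring
  have hi : ⟪a, ballInvolution a z⟫_ℂ = (1 - ⟪a, z⟫_ℂ)⁻¹ * (1 - ⟪a, z⟫_ℂ - defect a ^ 2) := by
    simp only [ballInvolution, liftDen, liftNum, inner_smul_right, inner_sub_right, h2]
    field_simp
    ring
  have hd : liftDen a 1 (ballInvolution a z) = (1 - ⟪a, z⟫_ℂ)⁻¹ * defect a ^ 2 := by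
    rw [liftDen, hi]; field_simp; ring
  rw [ballInvolution, hd, liftNum, hi]
  simp only [ballInvolution, liftDen, liftNum]
  match_scalars <;> field_simp
  ring

/-- The lift is linear in the homogeneous vector `(c, x)`, so differentiating `liftDen •
ballInvolution = liftNum` along `(0, u)` gives a formula free of denominators. The value `c = 0`
marks tangent vectors. -/
lemma hasFDerivAt_ballInvolution {a z : E} (ha : ‖a‖ < 1) (hz : ‖z‖ < 1) :
    ∃ D : E →L[ℂ] E, HasFDerivAt (ballInvolution a) D z ∧
      ∀ u, liftDen a 1 z • D u = liftNum a 0 u - liftDen a 0 u • ballInvolution a z := by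
  have hl : liftDen a 1 z ≠ 0 := one_sub_inner_ne_zero ha hz
  have h1 : HasFDerivAt (liftDen a 1) (-innerSL ℂ a) z :=
    ((innerSL ℂ a).hasFDerivAt (x := z)).const_sub 1
  have h2 : HasFDerivAt (liftNum a 1)
      ((-((1 + defect a)⁻¹ • innerSL ℂ a)).smulRight a
        - defect a • ContinuousLinearMap.id ℂ E) z := by
    have h3 : HasFDerivAt (fun x => (1 : ℂ) - ⟪a, x⟫_ℂ / (1 + defect a))
        (-((1 + defect a)⁻¹ • innerSL ℂ a)) z := by
      have := ((((1 + defect a)⁻¹ • innerSL ℂ a).hasFDerivAt (x := z))).const_sub 1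
      refine this.congr_of_eventuallyEq (Filter.Eventually.of_forall fun x => ?_)
      simp [div_eq_inv_mul]
    exact (h3.smul_const a).sub ((hasFDerivAt_id z).const_smul (defect a))
  refine ⟨_, ((hasDerivAt_inv hl).comp_hasFDerivAt z h1).smul h2, fun u => ?_⟩
  simp only [ballInvolution]
  simp [smul_smul, hl]
  simp only [liftNum, liftDen] at hl ⊢
  match_scalars <;> field_simp <;> ring

end Involution

/-! ### Invariance of the metric under the involutions. -/

section BallMetric

variable {n : ℕ}

local notation "ℂ^" n => EuclideanSpace ℂ (Fin n)

lemma one_sub_norm_sq_pos {E : Type*} [NormedAddCommGroup E] {z : E} (hz : ‖z‖ < 1) :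
    0 < 1 - ‖z‖ ^ 2 := by
  nlinarith [norm_nonneg z]

lemma ballMetric_self (z u : ℂ^n) :
    ballMetric n z u u
      = 2 * (‖u‖ ^ 2 / (1 - ‖z‖ ^ 2) + ‖⟪z, u⟫_ℂ‖ ^ 2 / (1 - ‖z‖ ^ 2) ^ 2) := by
  have h1 : (⟪u, u⟫_ℂ).re = ‖u‖ ^ 2 := inner_self_eq_norm_sq (𝕜 := ℂ) u
  have h2 : (⟪u, z⟫_ℂ * ⟪z, u⟫_ℂ).re = ‖⟪z, u⟫_ℂ‖ ^ 2 := by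
    rw [← inner_conj_symm u z, Complex.conj_mul', ← Complex.ofReal_pow, Complex.ofReal_re]
  rw [ballMetric, h1, h2]

lemma ofReal_ballMetric_self {z : ℂ^n} (hz : ‖z‖ < 1) (u : ℂ^n) :
    (ballMetric n z u u : ℂ)
      = 2 * ((⟪u, u⟫_ℂ * (1 - ⟪z, z⟫_ℂ) + ⟪u, z⟫_ℂ * ⟪z, u⟫_ℂ) / (1 - ⟪z, z⟫_ℂ) ^ 2) := by
  have h1 : (1 : ℂ) - (‖z‖ : ℂ) ^ 2 ≠ 0 := by exact_mod_cast (one_sub_norm_sq_pos hz).ne'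
  rw [ballMetric_self, ← inner_conj_symm u z, Complex.conj_mul', inner_self_eq_norm_sq_to_K,
    inner_self_eq_norm_sq_to_K]
  push_cast
  simp only [Complex.coe_algebraMap]
  field_simp

/-- The involutions are isometries of the ball metric. -/
lemma ballMetric_ballInvolution {a z : ℂ^n} (ha : ‖a‖ < 1) (hz : ‖z‖ < 1) {u U : ℂ^n}
    (hU : liftDen a 1 z • U = liftNum a 0 u - liftDen a 0 u • ballInvolution a z) :
    ballMetric n (ballInvolution a z) U U = ballMetric n z u u := by
  apply Complex.ofReal_injective
  rw [ofReal_ballMetric_self (norm_ballInvolution_lt ha hz), ofReal_ballMetric_self hz]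
  have hN : liftNum a 0 u = liftDen a 1 z • U + liftDen a 0 u • ballInvolution a z := by
    rw [hU]; abel
  have h1 := inner_self_ballInvolution ha hz
  have h2 := liftDen_mul_sub_inner_liftNum ha 1 0 z u
  have h3 := liftDen_mul_sub_inner_liftNum ha 0 1 u z
  have h4 := liftDen_mul_sub_inner_liftNum ha 0 0 u u
  rw [hN, ← liftDen_smul_ballInvolution ha hz] at h2 h3
  rw [hN] at h4
  simp only [inner_add_left, inner_add_right, inner_smul_left, inner_smul_right, map_one,
    map_zero, mul_zero, zero_mul, zero_sub] at h2 h3 h4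
  have hs := defect_ne_zero ha
  have hl : liftDen a 1 z ≠ 0 := one_sub_inner_ne_zero ha hz
  have hl' : conj (liftDen a 1 z) ≠ 0 := by simpa using hl
  have hz1 : 1 - ⟪z, z⟫_ℂ ≠ 0 := one_sub_inner_ne_zero hz hz
  have hp1 : 1 - ⟪ballInvolution a z, ballInvolution a z⟫_ℂ ≠ 0 :=
    one_sub_inner_ne_zero (norm_ballInvolution_lt ha hz) (norm_ballInvolution_lt ha hz)
  generalize liftDen a 1 z = l at *
  generalize liftDen a 0 u = k at *
  generalize ballInvolution a z = p at *
  generalize defect a = s at *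
  -- The numerator of the metric is minus the Gram determinant of `(1, z)` and `(0, u)` for the form
  -- of signature `(1, n)`. The lift scales the form by `s ^ 2` and sends the pair to `l (1, p)` and
  -- `l (0, U) + k (1, p)`; the shear by `k` does not change the determinant.
  have key : (conj l * l) ^ 2 * (⟪U, U⟫_ℂ * (1 - ⟪p, p⟫_ℂ) + ⟪U, p⟫_ℂ * ⟪p, U⟫_ℂ)
      = s ^ 4 * (⟪u, u⟫_ℂ * (1 - ⟪z, z⟫_ℂ) + ⟪u, z⟫_ℂ * ⟪z, u⟫_ℂ) := by
    have e : s ^ 4 * (⟪u, u⟫_ℂ * (1 - ⟪z, z⟫_ℂ) + ⟪u, z⟫_ℂ * ⟪z, u⟫_ℂ)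
        = -(s ^ 2 * -⟪u, u⟫_ℂ) * (s ^ 2 * (1 - ⟪z, z⟫_ℂ))
          + (s ^ 2 * -⟪u, z⟫_ℂ) * (s ^ 2 * -⟪z, u⟫_ℂ) := by ring
    rw [e, ← h1, ← h2, ← h3, ← h4]
    ring
  congr 1
  rw [div_eq_div_iff (pow_ne_zero _ hp1) (pow_ne_zero _ hz1)]
  apply mul_left_cancel₀ (pow_ne_zero 4 hs)
  calc _ = (⟪U, U⟫_ℂ * (1 - ⟪p, p⟫_ℂ) + ⟪U, p⟫_ℂ * ⟪p, U⟫_ℂ)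
            * (s ^ 2 * (1 - ⟪z, z⟫_ℂ)) ^ 2 := by ring
    _ = ((conj l * l) ^ 2 * (⟪U, U⟫_ℂ * (1 - ⟪p, p⟫_ℂ) + ⟪U, p⟫_ℂ * ⟪p, U⟫_ℂ))
            * (1 - ⟪p, p⟫_ℂ) ^ 2 := by rw [← h1]; ring
    _ = _ := by rw [key]; ring

end BallMetric

/-! ### The Levi-Civita connection of the ball metric. -/

section Christoffel

variable {n : ℕ}

local notation "ℂ^" n => EuclideanSpace ℂ (Fin n)

lemma differentiableAt_ballMetric {x : ℂ^n} (hx : ‖x‖ < 1) (v w : ℂ^n) :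
    DifferentiableAt ℝ (fun q => ballMetric n q v w) x := by
  have hD := (one_sub_norm_sq_pos hx).ne'
  have h0 : DifferentiableAt ℝ (fun q : ℂ^n => 1 - ‖q‖ ^ 2) x :=
    (differentiableAt_id.norm_sq ℂ).const_sub 1
  have h1 : DifferentiableAt ℝ (fun q : ℂ^n => (⟪v, q⟫_ℂ * ⟪q, w⟫_ℂ).re) x :=
    Complex.reCLM.differentiableAt.comp x
      (((differentiableAt_const v).inner ℂ differentiableAt_id).mul
        (differentiableAt_id.inner ℂ (differentiableAt_const w)))
  unfold ballMetric
  have hD2 : (1 - ‖x‖ ^ 2) ^ 2 ≠ 0 := pow_ne_zero 2 hD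
  fun_prop (disch := assumption)

lemma fderiv_ballMetric {x : ℂ^n} (hx : ‖x‖ < 1) (u v w : ℂ^n) :
    fderiv ℝ (fun q => ballMetric n q v w) x u
      = 2 * ((⟪v, w⟫_ℂ).re * (2 * (⟪x, u⟫_ℂ).re) / (1 - ‖x‖ ^ 2) ^ 2
        + (⟪v, u⟫_ℂ * ⟪x, w⟫_ℂ + ⟪v, x⟫_ℂ * ⟪u, w⟫_ℂ).re / (1 - ‖x‖ ^ 2) ^ 2
        + (⟪v, x⟫_ℂ * ⟪x, w⟫_ℂ).re * (4 * (⟪x, u⟫_ℂ).re) / (1 - ‖x‖ ^ 2) ^ 3) := by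
  have hD := (one_sub_norm_sq_pos hx).ne'
  rw [← (differentiableAt_ballMetric hx v w).lineDeriv_eq_fderiv]
  refine HasDerivAt.deriv ?_
  have hl : HasDerivAt (fun t : ℝ => x + t • u) u 0 := by
    simpa using ((hasDerivAt_id (0 : ℝ)).smul_const u).const_add x
  have h0 : HasDerivAt (fun t : ℝ => 1 - ‖x + t • u‖ ^ 2) (-(2 * (⟪x, u⟫_ℂ).re)) 0 := by
    have h : HasDerivAt (fun t : ℝ => (⟪x + t • u, x + t • u⟫_ℂ).re) (2 * (⟪x, u⟫_ℂ).re) 0 := by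
      have h := Complex.reCLM.hasFDerivAt.comp_hasDerivAt (0 : ℝ) (hl.inner ℂ hl)
      refine h.congr_deriv ?_
      simp only [zero_smul, add_zero, Complex.reCLM_apply, Complex.add_re]
      rw [← inner_conj_symm u x, Complex.conj_re]
      ring
    refine (h.const_sub 1).congr_of_eventuallyEq (Filter.Eventually.of_forall fun t => ?_)
    exact congrArg (1 - ·) (inner_self_eq_norm_sq (𝕜 := ℂ) (x + t • u)).symm
  have h1 : HasDerivAt (fun t : ℝ => (⟪v, x + t • u⟫_ℂ * ⟪x + t • u, w⟫_ℂ).re)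
      (⟪v, u⟫_ℂ * ⟪x, w⟫_ℂ + ⟪v, x⟫_ℂ * ⟪u, w⟫_ℂ).re 0 := by
    have h := Complex.reCLM.hasFDerivAt.comp_hasDerivAt (0 : ℝ)
      (((hasDerivAt_const (0 : ℝ) v).inner ℂ hl).mul (hl.inner ℂ (hasDerivAt_const (0 : ℝ) w)))
    refine h.congr_deriv ?_
    simp
  have hD' : 1 - ‖x + (0 : ℝ) • u‖ ^ 2 ≠ 0 := by simpa using hD
  refine ((((hasDerivAt_const (0 : ℝ) (⟪v, w⟫_ℂ).re).div h0 hD').add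
    (h1.div (h0.fun_pow 2) (pow_ne_zero 2 hD'))).const_mul 2).congr_deriv ?_
  simp only [zero_smul, add_zero]
  field_simp
  push_cast
  ring

lemma ballMetric_self_eq_zero {x c : ℂ^n} (hx : ‖x‖ < 1) (h : ballMetric n x c c = 0) :
    c = 0 := by
  have hD := one_sub_norm_sq_pos hx
  rw [ballMetric_self] at h
  have h1 : 0 ≤ ‖⟪x, c⟫_ℂ‖ ^ 2 / (1 - ‖x‖ ^ 2) ^ 2 := by positivity
  have h2 : 0 ≤ ‖c‖ ^ 2 / (1 - ‖x‖ ^ 2) := by positivity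
  have h3 : ‖c‖ ^ 2 / (1 - ‖x‖ ^ 2) = 0 := by linarith
  simpa [hD.ne'] using h3

lemma ballMetric_sub_left (x c d w : ℂ^n) :
    ballMetric n x (c - d) w = ballMetric n x c w - ballMetric n x d w := by
  simp only [ballMetric, inner_sub_left, sub_mul, Complex.sub_re]
  ring

/-- The geodesic acceleration of the ball metric: `-(2 ⟪x, u⟫ / (1 - |x|²)) u` at velocity `u`. -/
lemma christoffel_ballMetric_self {x : ℂ^n} (hx : ‖x‖ < 1) (u : ℂ^n) :
    christoffel (ballMetric n) x u u = (2 * ⟪x, u⟫_ℂ / (1 - ‖x‖ ^ 2 : ℝ)) • u := by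
  have hD := (one_sub_norm_sq_pos hx).ne'
  have hex : ∀ w, ballMetric n x ((2 * ⟪x, u⟫_ℂ / (1 - ‖x‖ ^ 2 : ℝ)) • u) w
      = christoffelFirst (ballMetric n) x u u w := by
    intro w
    simp only [christoffelFirst, fderiv_ballMetric hx]
    rw [ballMetric, inner_smul_left, inner_smul_left, map_div₀, Complex.conj_ofReal, map_mul,
      ← inner_conj_symm u x, ← inner_conj_symm w u]
    have huu : ⟪u, u⟫_ℂ = (‖u‖ ^ 2 : ℝ) := by
      rw [inner_self_eq_norm_sq_to_K]; push_cast; rfl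
    rw [huu]
    generalize ⟪x, u⟫_ℂ = p
    generalize ⟪x, w⟫_ℂ = q
    generalize ⟪u, w⟫_ℂ = r
    rw [div_mul_eq_mul_div, div_mul_eq_mul_div, div_mul_eq_mul_div, Complex.div_ofReal_re,
      Complex.div_ofReal_re]
    simp only [Complex.mul_re, Complex.mul_im, Complex.conj_re, Complex.conj_im, Complex.add_re,
      Complex.ofReal_re, Complex.ofReal_im, Complex.re_ofNat, Complex.im_ofNat, map_ofNat]
    field_simp
    ring
  -- The explicit vector proves existence, so `epsilon` returns a solution; definiteness of the
  -- metric then identifies the two.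
  have hspec := Classical.epsilon_spec
    (p := fun c : ℂ^n => ∀ w, ballMetric n x c w = christoffelFirst (ballMetric n) x u u w)
    ⟨_, hex⟩
  refine sub_eq_zero.1 (ballMetric_self_eq_zero hx ?_)
  rw [ballMetric_sub_left, hex, sub_eq_zero]
  exact hspec _

end Christoffel

/-! ### Images of rays as projectivized affine curves. -/

section Ray

lemma eq_zero_of_hasDerivAt_mul_self {c r : ℝ → ℂ} (hc : ContinuousOn c (Set.Icc 0 1))
    (hr : ∀ t ∈ Set.Icc (0 : ℝ) 1, HasDerivAt r (c t * r t) t) (h0 : r 0 = 0) :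
    ∀ t ∈ Set.Icc (0 : ℝ) 1, r t = 0 := by
  obtain ⟨K, hK⟩ := isCompact_Icc.exists_bound_of_continuousOn hc
  intro t ht
  have h := norm_le_gronwallBound_of_norm_deriv_right_le (f := r) (f' := fun t => c t * r t)
    (δ := 0) (K := K) (ε := 0) (a := 0) (b := 1)
    (fun t ht => (hr t ht).continuousAt.continuousWithinAt)
    (fun t ht => (hr t (Set.Ico_subset_Icc_self ht)).hasDerivWithinAt) (by simp [h0])
    (fun t ht => by
      rw [norm_mul, add_zero]
      exact mul_le_mul_of_nonneg_right (hK t (Set.Ico_subset_Icc_self ht)) (norm_nonneg _)) t ht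
  simpa [gronwallBound_ε0] using h

lemma apply_one_eq_of_hasDerivAt_const {E : Type*} [NormedAddCommGroup E] [NormedSpace ℝ E]
    {w w' : ℝ → E} (hw : ∀ t ∈ Set.Icc (0 : ℝ) 1, HasDerivAt w (w' t) t)
    (hw' : ∀ t ∈ Set.Icc (0 : ℝ) 1, HasDerivAt w' 0 t) : w 1 = w 0 + w' 0 := by
  have h1 := constant_of_has_deriv_right_zero
    (fun t ht => (hw' t ht).continuousAt.continuousWithinAt)
    (fun t ht => (hw' t (Set.Ico_subset_Icc_self ht)).hasDerivWithinAt)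
  have h2 : ∀ t ∈ Set.Icc (0 : ℝ) 1, HasDerivAt (fun t => w t - t • w' 0) 0 t := by
    intro t ht
    simpa [h1 t ht] using (hw t ht).fun_sub ((hasDerivAt_id t).smul_const (w' 0))
  have h3 := constant_of_has_deriv_right_zero
    (fun t ht => (h2 t ht).continuousAt.continuousWithinAt)
    (fun t ht => (h2 t (Set.Ico_subset_Icc_self ht)).hasDerivWithinAt) 1 (by simp)
  simpa [sub_eq_iff_eq_add] using h3

variable {E : Type*} [NormedAddCommGroup E] [InnerProductSpace ℂ E]

/-- A curve in the ball that is a geodesic up to the reparametrization of a ray of speed `√r` is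
the projectivization of an affine curve. -/
lemma geodesic_apply_one {x x' : ℝ → E} {r : ℝ} (hr0 : 0 ≤ r) (hr : r < 1)
    (hx1 : ∀ t ∈ Set.Icc (0 : ℝ) 1, ‖x t‖ < 1)
    (hx : ∀ t ∈ Set.Icc (0 : ℝ) 1, HasDerivAt x (x' t) t)
    (hx' : ∀ t ∈ Set.Icc (0 : ℝ) 1, HasDerivAt x'
      ((2 * (t * r / (1 - t ^ 2 * r) - ⟪x t, x' t⟫_ℂ / (1 - ⟪x t, x t⟫_ℂ)) : ℂ) • x' t) t)
    (hs : ∀ t ∈ Set.Icc (0 : ℝ) 1,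
      (⟪x' t, x' t⟫_ℂ * (1 - ⟪x t, x t⟫_ℂ) + ⟪x' t, x t⟫_ℂ * ⟪x t, x' t⟫_ℂ)
        / (1 - ⟪x t, x t⟫_ℂ) ^ 2 = r / (1 - t ^ 2 * r) ^ 2) :
    (1 + ⟪x 0, x' 0⟫_ℂ / (1 - ⟪x 0, x 0⟫_ℂ)) ≠ 0 ∧
      (1 + ⟪x 0, x' 0⟫_ℂ / (1 - ⟪x 0, x 0⟫_ℂ)) • x 1
        = x 0 + (x' 0 + (⟪x 0, x' 0⟫_ℂ / (1 - ⟪x 0, x 0⟫_ℂ)) • x 0) := by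
  set α : ℂ := ⟪x 0, x' 0⟫_ℂ / (1 - ⟪x 0, x 0⟫_ℂ) with hα
  -- With this `q` the second-order equation reads `x'' = -2 q x'`.
  set q : ℝ → ℂ := fun t => ⟪x t, x' t⟫_ℂ / (1 - ⟪x t, x t⟫_ℂ) - t * r / (1 - t ^ 2 * r) with hq
  have hden : ∀ t ∈ Set.Icc (0 : ℝ) 1, (1 - (t : ℂ) ^ 2 * r) ≠ 0 := by
    rintro t ⟨h0, h1⟩
    have : 0 < 1 - t ^ 2 * r := by nlinarith [mul_nonneg h0 hr0]
    exact_mod_cast this.ne'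
  have hof : ∀ t : ℝ, HasDerivAt (fun t : ℝ => (t : ℂ)) 1 t := fun t =>
    (hasDerivAt_id (t : ℂ)).comp_ofReal
  -- The Riccati equation `q' = -q²`; the speed identity `hs` is used to eliminate `⟪x', x'⟫`.
  have hqd : ∀ t ∈ Set.Icc (0 : ℝ) 1, HasDerivAt q (-q t * q t) t := by
    intro t ht
    have hD : 1 - ⟪x t, x t⟫_ℂ ≠ 0 := one_sub_inner_ne_zero (hx1 t ht) (hx1 t ht)
    have h1 := ((hx t ht).inner ℂ (hx' t ht)).div (((hx t ht).inner ℂ (hx t ht)).const_sub 1) hD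
    have h2 := ((hof t).mul_const (r : ℂ)).div
      ((((hof t).fun_pow 2).mul_const (r : ℂ)).const_sub 1) (hden t ht)
    refine (h1.sub h2).congr_deriv ?_
    have hst := hs t ht
    have hdt := hden t ht
    simp only [hq, inner_smul_right]
    generalize 1 - ⟪x t, x t⟫_ℂ = D at *
    generalize ⟪x t, x' t⟫_ℂ = p at *
    generalize ⟪x' t, x t⟫_ℂ = p' at *
    generalize ⟪x' t, x' t⟫_ℂ = N at *
    generalize (t : ℂ) = τ at *
    generalize (r : ℂ) = ρ at *
    have e : (N * D + p' * p) / D ^ 2 = N / D + p' * p / D ^ 2 := by field_simp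
    rw [e] at hst
    have e2 : N / D = ρ / (1 - τ ^ 2 * ρ) ^ 2 - p' * p / D ^ 2 := by rw [← hst]; ring
    have e3 : N = (ρ / (1 - τ ^ 2 * ρ) ^ 2 - p' * p / D ^ 2) * D := by
      rw [← e2]; field_simp
    rw [e3]
    push_cast
    field_simp
    ring
  have hq0 : q 0 = α := by simp [hq, hα]
  have hcont : ContinuousOn q (Set.Icc 0 1) := fun t ht =>
    (hqd t ht).continuousAt.continuousWithinAt
  have hlin : ∀ t : ℝ, HasDerivAt (fun t : ℝ => 1 + α * (t : ℂ)) α t := fun t => by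
    simpa using ((hof t).const_mul α).const_add 1
  -- This is `q = α / (1 + α t)` with the denominator cleared, since `1 + α t ≠ 0` is not yet known.
  -- The difference satisfies a homogeneous linear equation and vanishes at `0`.
  have hric := eq_zero_of_hasDerivAt_mul_self (c := fun t => -q t)
    (r := fun t => q t * (1 + α * t) - α) hcont.neg (fun t ht => by
      refine (((hqd t ht).mul (hlin t)).sub_const α).congr_deriv ?_
      ring) (by simp [hq0])
  refine ⟨fun h => ?_, ?_⟩
  -- If `1 + α = 0`, the relation at `t = 1` gives `α = 0`, a contradiction.
  · have h1 := hric 1 (by simp)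
    simp only [Complex.ofReal_one, mul_one, h, mul_zero, zero_sub, neg_eq_zero] at h1
    rw [h1, add_zero] at h
    exact one_ne_zero h
  · have := apply_one_eq_of_hasDerivAt_const (w := fun t => (1 + α * (t : ℂ)) • x t)
      -- The second derivative of `(1 + α t) • x` is `2 (α - q (1 + α t)) • x'`, which is zero.
      (w' := fun t => (1 + α * (t : ℂ)) • x' t + α • x t)
      (fun t ht => (hlin t).smul (hx t ht))
      (fun t ht => by
        refine (((hlin t).smul (hx' t ht)).add ((hx t ht).const_smul α)).congr_deriv ?_
        have h1 := hric t ht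
        simp only [hq] at h1
        rw [smul_smul, ← add_smul, ← add_smul]
        convert zero_smul ℂ (x' t) using 2
        linear_combination (-2) * h1)
    simpa using this

end Ray

/-! ### Real-linear isometries that are complex linear or antilinear. -/

section RealIsometry

variable {E F : Type*} [NormedAddCommGroup E] [InnerProductSpace ℂ E]
  [NormedAddCommGroup F] [InnerProductSpace ℂ F]

/-- Polarizing the norm makes `⟪B u, B (i u)⟫` purely imaginary, and its modulus is `‖u‖²`. This is
the equality case of Cauchy–Schwarz, so `B (i u)` is `i B u` or `-i B u`. -/
lemma map_I_smul_eq_or {B : E →ₗ[ℝ] F} (hn : ∀ u, ‖B u‖ = ‖u‖)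
    (hi : ∀ z u, ‖⟪B z, B u⟫_ℂ‖ = ‖⟪z, u⟫_ℂ‖) (u : E) :
    B (Complex.I • u) = Complex.I • B u ∨ B (Complex.I • u) = -(Complex.I • B u) := by
  have hIn : ‖B (Complex.I • u)‖ = ‖u‖ := by rw [hn, norm_smul]; simp
  have huu : ⟪u, Complex.I • u⟫_ℂ = Complex.I * (‖u‖ ^ 2 : ℝ) := by
    rw [inner_smul_right, inner_self_eq_norm_sq_to_K]; push_cast; rfl
  have hre : (⟪B u, B (Complex.I • u)⟫_ℂ).re = 0 := by
    have h1 := norm_add_sq (𝕜 := ℂ) (B u) (B (Complex.I • u))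
    have h2 := norm_add_sq (𝕜 := ℂ) u (Complex.I • u)
    rw [← map_add, hn, hn, hn, h2, huu] at h1
    simp only [RCLike.re_to_complex, Complex.re_mul_ofReal, Complex.I_re, zero_mul] at h1
    linarith
  have him : (⟪B u, B (Complex.I • u)⟫_ℂ).im ^ 2 = (‖u‖ ^ 2) ^ 2 := by
    have h1 := hi u (Complex.I • u)
    rw [huu, norm_mul, Complex.norm_I, one_mul, Complex.norm_real, norm_pow, norm_norm] at h1
    rw [← h1, Complex.sq_norm, Complex.normSq_apply, hre]
    ring
  have hIB : (⟪Complex.I • B u, B (Complex.I • u)⟫_ℂ).re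
      = (⟪B u, B (Complex.I • u)⟫_ℂ).im := by
    rw [inner_smul_left]; simp
  have hIBn : ‖Complex.I • B u‖ = ‖u‖ := by rw [norm_smul, hn]; simp
  rcases sq_eq_sq_iff_eq_or_eq_neg.1 him with h | h
  · left
    have h1 := norm_sub_sq (𝕜 := ℂ) (Complex.I • B u) (B (Complex.I • u))
    rw [RCLike.re_to_complex, hIB, h, hIn, hIBn] at h1
    have h2 : ‖Complex.I • B u - B (Complex.I • u)‖ ^ 2 = 0 := by rw [h1]; ring
    exact (sub_eq_zero.1 (norm_eq_zero.1 (pow_eq_zero_iff two_ne_zero |>.1 h2))).symm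
  · right
    have h1 := norm_add_sq (𝕜 := ℂ) (Complex.I • B u) (B (Complex.I • u))
    rw [RCLike.re_to_complex, hIB, h, hIn, hIBn] at h1
    have h2 : ‖Complex.I • B u + B (Complex.I • u)‖ ^ 2 = 0 := by rw [h1]; ring
    exact eq_neg_of_add_eq_zero_right (norm_eq_zero.1 (pow_eq_zero_iff two_ne_zero |>.1 h2))

/-- A real-linear isometry preserving the modulus of the Hermitian product is complex linear or
antilinear. -/
lemma forall_map_I_smul_or {B : E →ₗ[ℝ] F} (hn : ∀ u, ‖B u‖ = ‖u‖)
    (hi : ∀ z u, ‖⟪B z, B u⟫_ℂ‖ = ‖⟪z, u⟫_ℂ‖) :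
    (∀ u, B (Complex.I • u) = Complex.I • B u) ∨
      (∀ u, B (Complex.I • u) = -(Complex.I • B u)) := by
  -- Each alternative holds on an additive subgroup, and a group is not the union of two proper
  -- subgroups: `u + w` would lie in neither.
  by_contra! h
  obtain ⟨⟨u, hu⟩, ⟨w, hw⟩⟩ := h
  have hu' := (map_I_smul_eq_or hn hi u).resolve_left hu
  have hw' := (map_I_smul_eq_or hn hi w).resolve_right hw
  rcases map_I_smul_eq_or hn hi (u + w) with h | h
  · rw [smul_add, map_add, map_add, smul_add, hw', add_left_inj] at h
    exact hu h
  · rw [smul_add, map_add, map_add, smul_add, hu', neg_add, add_right_inj] at h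
    exact hw h

/-- A norm-preserving real-linear map commuting with `i`, as a complex linear isometry. -/
noncomputable def complexIsometry (B : E →ₗ[ℝ] F) (hn : ∀ u, ‖B u‖ = ‖u‖)
    (hI : ∀ u, B (Complex.I • u) = Complex.I • B u) : E →ₗᵢ[ℂ] F where
  toFun := B
  map_add' := map_add B
  map_smul' c u := by
    rw [RingHom.id_apply, ← Complex.re_add_im c, add_smul, add_smul, mul_smul, mul_smul,
      Complex.coe_smul, Complex.coe_smul, Complex.coe_smul, Complex.coe_smul, map_add,
      map_smul, map_smul, hI]
  norm_map' := hn

/-- The isometry `P ∘ B⁻¹` on the range of `B` extends to all of `F`, and in finite dimension the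
extension is unitary. -/
lemma exists_linearIsometryEquiv_comp_eq [FiniteDimensional ℂ F] (B P : E →ₗᵢ[ℂ] F) :
    ∃ U : F ≃ₗᵢ[ℂ] F, ∀ z, U (B z) = P z := by
  let L := P.comp B.equivRange.symm.toLinearIsometry
  refine ⟨L.extend.toLinearIsometryEquiv rfl, fun z => ?_⟩
  have h := L.extend_apply (B.equivRange z)
  simpa [L] using h

end RealIsometry

/-! ### Coordinate inclusion and conjugation. -/

section Coordinates

variable {n : ℕ}

local notation "ℂ^" n => EuclideanSpace ℂ (Fin n)

/-- `padZero` as a linear isometry. -/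
noncomputable def padZeroIsometry {m : ℕ} (h : n ≤ m) : (ℂ^n) →ₗᵢ[ℂ] (ℂ^m) where
  toFun := padZero m
  map_add' z w := by
    ext j
    by_cases hj : j.val < n <;> simp [padZero, hj]
  map_smul' c z := by
    ext j
    by_cases hj : j.val < n <;> simp [padZero, hj]
  norm_map' z := by
    obtain ⟨k, rfl⟩ := Nat.exists_eq_add_of_le h
    simp [EuclideanSpace.norm_eq, padZero, Fin.sum_univ_add]

/-- `conjVec` as a real-linear map. -/
noncomputable def conjVecLinear : (ℂ^n) →ₗ[ℝ] (ℂ^n) where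
  toFun := conjVec
  map_add' z w := by ext j; simp [conjVec]
  map_smul' c z := by ext j; simp [conjVec]

lemma norm_conjVec (z : ℂ^n) : ‖conjVec z‖ = ‖z‖ := by
  simp [EuclideanSpace.norm_eq, conjVec]

lemma conjVec_conjVec (z : ℂ^n) : conjVec (conjVec z) = z := by
  ext j; simp [conjVec]

lemma conjVec_I_smul (z : ℂ^n) : conjVec (Complex.I • z) = -(Complex.I • conjVec z) := by
  ext j; simp [conjVec]

end Coordinates

/-! ### Automorphisms used for normalization. -/

section BallAut

variable {n : ℕ}

local notation "ℂ^" n => EuclideanSpace ℂ (Fin n)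

lemma mem_unitBall {z : ℂ^n} : z ∈ unitBall n ↔ ‖z‖ < 1 := by simp [unitBall]

lemma isBallAut_id : IsBallAut (id : (ℂ^n) → ℂ^n) :=
  ⟨differentiableOn_id, Set.mapsTo_id _, id, differentiableOn_id, Set.mapsTo_id _,
    fun _ _ => rfl, fun _ _ => rfl⟩

lemma isBallAut_linearIsometryEquiv_comp_ballInvolution {a : ℂ^n} (ha : ‖a‖ < 1)
    (U : (ℂ^n) ≃ₗᵢ[ℂ] (ℂ^n)) : IsBallAut fun z => U (ballInvolution a z) := by
  have hd : DifferentiableOn ℂ (ballInvolution a) (unitBall n) := fun z hz =>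
    let ⟨_, hD, _⟩ := hasFDerivAt_ballInvolution ha (mem_unitBall.1 hz)
    hD.differentiableAt.differentiableWithinAt
  have hm : Set.MapsTo (ballInvolution a) (unitBall n) (unitBall n) := fun z hz =>
    mem_unitBall.2 (norm_ballInvolution_lt ha (mem_unitBall.1 hz))
  have hU : Set.MapsTo U.symm (unitBall n) (unitBall n) := fun z hz => by
    rw [mem_unitBall, U.symm.norm_map]; exact mem_unitBall.1 hz
  refine ⟨U.differentiable.comp_differentiableOn hd, fun z hz => ?_,
    fun z => ballInvolution a (U.symm z),
    hd.comp U.symm.differentiable.differentiableOn hU, fun z hz => hm (hU hz), ?_, ?_⟩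
  · rw [mem_unitBall, U.norm_map]; exact mem_unitBall.1 (hm hz)
  · intro z hz
    simp [ballInvolution_ballInvolution ha (mem_unitBall.1 hz)]
  · intro z hz
    simp [ballInvolution_ballInvolution ha (mem_unitBall.1 (hU hz))]

end BallAut

/-! ### Linearity of `f` after an involution. -/

section TotallyGeodesic

variable {n m : ℕ}

local notation "ℂ^" n => EuclideanSpace ℂ (Fin n)

/-- The derivative at `a` of `ballInvolution a`. -/
noncomputable def involutionDeriv {E : Type*} [NormedAddCommGroup E] [InnerProductSpace ℂ E]
    (a : E) : E →L[ℂ] E :=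
  -(((defect a ^ 2 * (1 + defect a))⁻¹ • innerSL ℂ a).smulRight a
    + (defect a)⁻¹ • ContinuousLinearMap.id ℂ E)

/-- The hypothesis is the endpoint formula of `geodesic_apply_one`. The vector `(α, w + α a)` is
orthogonal to `(1, a)` for the indefinite form, so the lifted denominator of `(1 + α, a + w + α a)`
is `defect a ^ 2`, independent of `w`. The image is thus linear in `w`. -/
lemma ballInvolution_eq_involutionDeriv {E : Type*} [NormedAddCommGroup E]
    [InnerProductSpace ℂ E] {a y w : E} (ha : ‖a‖ < 1)
    (h0 : 1 + ⟪a, w⟫_ℂ / (1 - ⟪a, a⟫_ℂ) ≠ 0)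
    (h : (1 + ⟪a, w⟫_ℂ / (1 - ⟪a, a⟫_ℂ)) • y = a + (w + (⟪a, w⟫_ℂ / (1 - ⟪a, a⟫_ℂ)) • a)) :
    ballInvolution a y = involutionDeriv a w := by
  have hs := one_add_defect_ne_zero a
  have hs0 := defect_ne_zero ha
  have h2 : ⟪a, a⟫_ℂ = 1 - defect a ^ 2 := by rw [defect_sq ha]; ring
  rw [← defect_sq ha] at h h0
  set α := ⟪a, w⟫_ℂ / defect a ^ 2 with hα
  have hw : ⟪a, w⟫_ℂ = α * defect a ^ 2 := by rw [hα]; field_simp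
  have hy' : y = (1 + α)⁻¹ • (a + (w + α • a)) := by rw [← h, inv_smul_smul₀ h0]
  have hay : ⟪a, y⟫_ℂ = (1 + α)⁻¹ * (1 - defect a ^ 2 + α) := by
    rw [hy', inner_smul_right, inner_add_right, inner_add_right, inner_smul_right, h2, hw]
    ring
  have hl : liftDen a 1 y = (1 + α)⁻¹ * defect a ^ 2 := by
    rw [liftDen, hay]; field_simp; ring
  have hR : involutionDeriv a w = -((α / (1 + defect a)) • a + (defect a)⁻¹ • w) := by
    simp only [involutionDeriv, neg_apply, add_apply,
      ContinuousLinearMap.smulRight_apply, smul_apply, innerSL_apply_apply,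
      ContinuousLinearMap.id_apply, hw, smul_eq_mul]
    congr 3
    field_simp
  rw [hR, ballInvolution, hl, liftNum, hay, hy']
  match_scalars <;> field_simp
  ring

lemma norm_real_smul_sq {E : Type*} [NormedAddCommGroup E] [NormedSpace ℝ E] (t : ℝ) (v : E) :
    ‖t • v‖ ^ 2 = t ^ 2 * ‖v‖ ^ 2 := by
  rw [norm_smul, mul_pow, Real.norm_eq_abs, sq_abs]

lemma hasDerivAt_apply_smul {E F : Type*} [NormedAddCommGroup E] [NormedSpace ℝ E]
    [NormedAddCommGroup F] [NormedSpace ℝ F] {f : E → F} {v : E} {t : ℝ}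
    (h : DifferentiableAt ℝ f (t • v)) :
    HasDerivAt (fun t : ℝ => f (t • v)) (fderiv ℝ f (t • v) v) t := by
  have hray : HasDerivAt (fun t : ℝ => t • v) v t := by
    simpa using (hasDerivAt_id t).smul_const v
  exact h.hasFDerivAt.comp_hasDerivAt t hray

lemma hasDerivAt_fderiv_smul {E F : Type*} [NormedAddCommGroup E] [NormedSpace ℝ E]
    [NormedAddCommGroup F] [NormedSpace ℝ F] {f : E → F} {v : E} {t : ℝ}
    (h : DifferentiableAt ℝ (fderiv ℝ f) (t • v)) :
    HasDerivAt (fun t : ℝ => fderiv ℝ f (t • v) v) (fderiv ℝ (fderiv ℝ f) (t • v) v v) t :=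
  (ContinuousLinearMap.apply ℝ F v).hasFDerivAt.comp_hasDerivAt t (hasDerivAt_apply_smul h)

lemma ballMetric_smul_self {v : ℂ^n} {t : ℝ} (hv : ‖t • v‖ < 1) :
    ballMetric n (t • v) v v = 2 * (‖v‖ ^ 2 / (1 - t ^ 2 * ‖v‖ ^ 2) ^ 2) := by
  have hD := (one_sub_norm_sq_pos hv).ne'
  have hin : ‖⟪t • v, v⟫_ℂ‖ ^ 2 = t ^ 2 * ‖v‖ ^ 4 := by
    rw [← Complex.coe_smul, inner_smul_left, Complex.conj_ofReal, inner_self_eq_norm_sq_to_K,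
      norm_mul, norm_pow, Complex.norm_real, mul_pow, Real.norm_eq_abs, sq_abs]
    simp only [Complex.coe_algebraMap, Complex.norm_real, norm_norm]
    ring
  rw [norm_real_smul_sq] at hD
  rw [ballMetric_self, hin, norm_real_smul_sq]
  field_simp
  ring

variable {f : (ℂ^n) → ℂ^m}

namespace IsTotallyGeodesicIsometricEmbedding

lemma contDiffAt (hf : IsTotallyGeodesicIsometricEmbedding (unitBall n) (unitBall m)
    (ballMetric n) (ballMetric m) f) {z : ℂ^n} (hz : ‖z‖ < 1) : ContDiffAt ℝ 2 f z :=
  hf.contDiffOn.contDiffAt (Metric.isOpen_ball.mem_nhds (mem_unitBall.2 hz))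

lemma norm_lt (hf : IsTotallyGeodesicIsometricEmbedding (unitBall n) (unitBall m)
    (ballMetric n) (ballMetric m) f) {z : ℂ^n} (hz : ‖z‖ < 1) : ‖f z‖ < 1 :=
  mem_unitBall.1 (hf.mapsTo (mem_unitBall.2 hz))

lemma fderiv_fderiv (hf : IsTotallyGeodesicIsometricEmbedding (unitBall n) (unitBall m)
    (ballMetric n) (ballMetric m) f) {v : ℂ^n} {t : ℝ} (hv : ‖t • v‖ < 1) :
    fderiv ℝ (fderiv ℝ f) (t • v) v v
      = (2 * (t * (‖v‖ ^ 2 : ℝ) / (1 - t ^ 2 * (‖v‖ ^ 2 : ℝ))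
          - ⟪f (t • v), fderiv ℝ f (t • v) v⟫_ℂ / (1 - ⟪f (t • v), f (t • v)⟫_ℂ)) : ℂ)
        • fderiv ℝ f (t • v) v := by
  have h := hf.totallyGeodesic _ (mem_unitBall.2 hv) v v
  rw [secondFundamentalForm, christoffel_ballMetric_self hv,
    christoffel_ballMetric_self (hf.norm_lt hv)] at h
  have hc : (2 * ⟪t • v, v⟫_ℂ / (1 - ‖t • v‖ ^ 2 : ℝ) : ℂ)
      = (2 * (t * ‖v‖ ^ 2 / (1 - t ^ 2 * ‖v‖ ^ 2)) : ℝ) := by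
    rw [norm_real_smul_sq, ← Complex.coe_smul, inner_smul_left, inner_self_eq_norm_sq_to_K,
      Complex.conj_ofReal]
    push_cast
    simp only [Complex.coe_algebraMap]
    ring
  -- `fderiv ℝ f` is only real linear; on a ray through `0` the source coefficient is real and can
  -- be pulled out.
  have hdf : ∀ c : ℝ, fderiv ℝ f (t • v) ((c : ℂ) • v) = (c : ℂ) • fderiv ℝ f (t • v) v := by
    intro c
    rw [Complex.coe_smul, map_smul, Complex.coe_smul]
  rw [hc, hdf, sub_add, sub_eq_zero, ← sub_smul] at h
  rw [h, inner_self_eq_norm_sq_to_K]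
  congr 1
  push_cast
  simp only [Complex.coe_algebraMap]
  ring

lemma ballInvolution_apply (hf : IsTotallyGeodesicIsometricEmbedding (unitBall n) (unitBall m)
    (ballMetric n) (ballMetric m) f) {v : ℂ^n} (hv : ‖v‖ < 1) :
    ballInvolution (f 0) (f v) = involutionDeriv (f 0) (fderiv ℝ f 0 v) := by
  have htv : ∀ t ∈ Set.Icc (0 : ℝ) 1, ‖t • v‖ < 1 := fun t ht => by
    rw [norm_smul, Real.norm_of_nonneg ht.1]
    exact (mul_le_of_le_one_left (norm_nonneg v) ht.2).trans_lt hv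
  have hx' : ∀ t ∈ Set.Icc (0 : ℝ) 1, HasDerivAt (fun t : ℝ => fderiv ℝ f (t • v) v)
      (fderiv ℝ (fderiv ℝ f) (t • v) v v) t := by
    intro t ht
    have h1 : DifferentiableAt ℝ (fderiv ℝ f) (t • v) :=
      ((hf.contDiffAt (htv t ht)).fderiv_right (m := 1) (by norm_num)).differentiableAt
        one_ne_zero
    exact hasDerivAt_fderiv_smul h1
  have hspeed : ∀ t ∈ Set.Icc (0 : ℝ) 1,
      (⟪fderiv ℝ f (t • v) v, fderiv ℝ f (t • v) v⟫_ℂ * (1 - ⟪f (t • v), f (t • v)⟫_ℂ)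
        + ⟪fderiv ℝ f (t • v) v, f (t • v)⟫_ℂ * ⟪f (t • v), fderiv ℝ f (t • v) v⟫_ℂ)
        / (1 - ⟪f (t • v), f (t • v)⟫_ℂ) ^ 2
      = (‖v‖ ^ 2 : ℝ) / (1 - t ^ 2 * (‖v‖ ^ 2 : ℝ)) ^ 2 := by
    intro t ht
    have h := hf.isometric _ (mem_unitBall.2 (htv t ht)) v v
    rw [ballMetric_smul_self (htv t ht), ← Complex.ofReal_inj,
      ofReal_ballMetric_self (hf.norm_lt (htv t ht)), Complex.ofReal_mul, Complex.ofReal_ofNat]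
      at h
    refine (mul_left_cancel₀ two_ne_zero h).trans ?_
    push_cast
    rfl
  have hx : ∀ t ∈ Set.Icc (0 : ℝ) 1,
      HasDerivAt (fun t : ℝ => f (t • v)) (fderiv ℝ f (t • v) v) t := fun t ht =>
    hasDerivAt_apply_smul ((hf.contDiffAt (htv t ht)).differentiableAt two_ne_zero)
  have key := geodesic_apply_one (r := ‖v‖ ^ 2) (by positivity) (by nlinarith [norm_nonneg v])
    (fun t ht => hf.norm_lt (htv t ht)) hx
    (fun t ht => (hx' t ht).congr_deriv (hf.fderiv_fderiv (htv t ht))) hspeed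
  simp only [zero_smul, one_smul] at key
  have h0 : ‖(0 : ℂ^n)‖ < 1 := by simp
  exact ballInvolution_eq_involutionDeriv (hf.norm_lt h0) key.1 key.2

end IsTotallyGeodesicIsometricEmbedding

end TotallyGeodesic

/-! ### The linearized map is a Hermitian or anti-Hermitian isometry. -/

section Linearization

variable {n m : ℕ}

local notation "ℂ^" n => EuclideanSpace ℂ (Fin n)

variable {f : (ℂ^n) → ℂ^m}

/-- The derivative at `0` of `f` followed by the involution exchanging `0` and `f 0`. -/
noncomputable def linearization (f : (ℂ^n) → ℂ^m) : (ℂ^n) →L[ℝ] ℂ^m :=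
  ((involutionDeriv (f 0)).restrictScalars ℝ).comp (fderiv ℝ f 0)

namespace IsTotallyGeodesicIsometricEmbedding

lemma ballInvolution_apply_eq_linearization
    (hf : IsTotallyGeodesicIsometricEmbedding (unitBall n) (unitBall m)
      (ballMetric n) (ballMetric m) f) {v : ℂ^n} (hv : ‖v‖ < 1) :
    ballInvolution (f 0) (f v) = linearization f v :=
  hf.ballInvolution_apply hv

lemma norm_apply_zero_lt (hf : IsTotallyGeodesicIsometricEmbedding (unitBall n) (unitBall m)
    (ballMetric n) (ballMetric m) f) : ‖f 0‖ < 1 := hf.norm_lt (by simp)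

/-- On the ball `f` is the linearization followed by the involution; since `f` and the involution
preserve the metric, so does the linearization. -/
lemma ballMetric_linearization
    (hf : IsTotallyGeodesicIsometricEmbedding (unitBall n) (unitBall m)
      (ballMetric n) (ballMetric m) f) {z : ℂ^n} (hz : ‖z‖ < 1) (u : ℂ^n) :
    ballMetric m (linearization f z) (linearization f u) (linearization f u)
      = ballMetric n z u u := by
  have ha := hf.norm_apply_zero_lt
  have hB : ‖linearization f z‖ < 1 := by
    rw [← hf.ballInvolution_apply_eq_linearization hz]
    exact norm_ballInvolution_lt ha (hf.norm_lt hz)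
  have hfB : ∀ w : ℂ^n, ‖w‖ < 1 → ballInvolution (f 0) (linearization f w) = f w := fun w hw => by
    rw [← hf.ballInvolution_apply_eq_linearization hw,
      ballInvolution_ballInvolution ha (hf.norm_lt hw)]
  obtain ⟨D, hD, hDu⟩ := hasFDerivAt_ballInvolution ha hB
  have hfd : HasFDerivAt f ((D.restrictScalars ℝ).comp (linearization f)) z := by
    refine ((hD.restrictScalars ℝ).comp z (linearization f).hasFDerivAt).congr_of_eventuallyEq ?_
    filter_upwards [Metric.isOpen_ball.mem_nhds (mem_unitBall.2 hz)] with w hw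
    exact (hfB w (mem_unitBall.1 hw)).symm
  have h := hf.isometric z (mem_unitBall.2 hz) u u
  rw [hfd.fderiv, ← hfB z hz] at h
  rw [← h, ← ballMetric_ballInvolution ha hB (hDu (linearization f u))]
  rfl

lemma norm_linearization (hf : IsTotallyGeodesicIsometricEmbedding (unitBall n) (unitBall m)
    (ballMetric n) (ballMetric m) f) (u : ℂ^n) : ‖linearization f u‖ = ‖u‖ := by
  have h := hf.ballMetric_linearization (z := 0) (by simp) u
  rw [ballMetric_self, ballMetric_self] at h
  simp only [map_zero, inner_zero_left, norm_zero] at h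
  have h2 : ‖linearization f u‖ ^ 2 = ‖u‖ ^ 2 := by linarith
  exact (sq_eq_sq₀ (norm_nonneg _) (norm_nonneg _)).1 h2

lemma norm_inner_linearization (hf : IsTotallyGeodesicIsometricEmbedding (unitBall n) (unitBall m)
    (ballMetric n) (ballMetric m) f) (z u : ℂ^n) :
    ‖⟪linearization f z, linearization f u⟫_ℂ‖ = ‖⟪z, u⟫_ℂ‖ := by
  -- The metric gives information only inside the ball, but both sides are homogeneous in `z`.
  wlog hz : ‖z‖ < 1 generalizing z
  · have hc : 0 < ‖z‖ + 1 := by positivity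
    have h := this ((‖z‖ + 1)⁻¹ • z) (by
      rw [norm_smul, norm_inv, Real.norm_of_nonneg hc.le, inv_mul_lt_one₀ hc]
      linarith)
    rw [map_smul, ← Complex.coe_smul, ← Complex.coe_smul, inner_smul_left, inner_smul_left,
      norm_mul, norm_mul] at h
    refine mul_left_cancel₀ ?_ h
    rw [Complex.conj_ofReal, Complex.norm_real]
    exact norm_ne_zero_iff.2 (inv_ne_zero hc.ne')
  have h := hf.ballMetric_linearization hz u
  rw [ballMetric_self, ballMetric_self, hf.norm_linearization, hf.norm_linearization] at h
  have hD := (one_sub_norm_sq_pos hz).ne'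
  have h1 : ‖⟪linearization f z, linearization f u⟫_ℂ‖ ^ 2 / (1 - ‖z‖ ^ 2) ^ 2
      = ‖⟪z, u⟫_ℂ‖ ^ 2 / (1 - ‖z‖ ^ 2) ^ 2 := by linarith
  rw [div_left_inj' (pow_ne_zero 2 hD)] at h1
  exact (sq_eq_sq₀ (norm_nonneg _) (norm_nonneg _)).1 h1

/-- `f` is the restriction of a complex linear or antilinear isometry, up to an involution. -/
lemma exists_linearIsometry (hf : IsTotallyGeodesicIsometricEmbedding (unitBall n) (unitBall m)
    (ballMetric n) (ballMetric m) f) :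
    ∃ B : (ℂ^n) →ₗᵢ[ℂ] ℂ^m,
      (∀ z, ‖z‖ < 1 → ballInvolution (f 0) (f z) = B z) ∨
        (∀ z, ‖z‖ < 1 → ballInvolution (f 0) (f z) = B (conjVec z)) := by
  rcases forall_map_I_smul_or (B := (linearization f : (ℂ^n) →ₗ[ℝ] ℂ^m)) hf.norm_linearization
    hf.norm_inner_linearization with h | h
  · exact ⟨complexIsometry _ hf.norm_linearization h,
      Or.inl fun z hz => hf.ballInvolution_apply_eq_linearization hz⟩
  -- Precomposing the antilinear map with conjugation makes it complex linear.
  · refine ⟨complexIsometry ((linearization f : (ℂ^n) →ₗ[ℝ] ℂ^m).comp conjVecLinear)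
      (fun u => (hf.norm_linearization _).trans (norm_conjVec u)) fun u => ?_,
      Or.inr fun z hz => ?_⟩
    · change linearization f (conjVec (Complex.I • u)) = Complex.I • linearization f (conjVec u)
      rw [conjVec_I_smul, map_neg]
      exact neg_eq_iff_eq_neg.2 (h (conjVec u))
    · rw [hf.ballInvolution_apply_eq_linearization hz]
      exact congrArg (linearization f) (conjVec_conjVec z).symm

end IsTotallyGeodesicIsometricEmbedding

end Linearization

end BallGeometry

theorem corollary3p3 (n m : ℕ)
    (f : EuclideanSpace ℂ (Fin n) → EuclideanSpace ℂ (Fin m))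
    (hf : BallGeometry.IsTotallyGeodesicIsometricEmbedding
      (BallGeometry.unitBall n) (BallGeometry.unitBall m)
      (BallGeometry.ballMetric n) (BallGeometry.ballMetric m) f) :
    n ≤ m ∧
      ∃ (φ : EuclideanSpace ℂ (Fin n) → EuclideanSpace ℂ (Fin n))
        (ψ : EuclideanSpace ℂ (Fin m) → EuclideanSpace ℂ (Fin m)),
        BallGeometry.IsBallAut φ ∧ BallGeometry.IsBallAut ψ ∧
          ((∀ z ∈ BallGeometry.unitBall n,
              ψ (f (φ z)) = BallGeometry.padZero m z) ∨
            (∀ z ∈ BallGeometry.unitBall n,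
              ψ (f (φ z)) = BallGeometry.padZero m (BallGeometry.conjVec z))) := by
  obtain ⟨B, hB⟩ := hf.exists_linearIsometry
  have hnm : n ≤ m := by
    simpa using LinearMap.finrank_le_finrank_of_injective (f := B.toLinearMap) B.injective
  obtain ⟨U, hU⟩ := BallGeometry.exists_linearIsometryEquiv_comp_eq B
    (BallGeometry.padZeroIsometry hnm)
  -- All normalization takes place in the target: the involution moves `f 0` to `0` and `U`
  -- straightens the image, so `φ` can be the identity.
  refine ⟨hnm, id, fun z => U (BallGeometry.ballInvolution (f 0) z), BallGeometry.isBallAut_id,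
    BallGeometry.isBallAut_linearIsometryEquiv_comp_ballInvolution hf.norm_apply_zero_lt U, ?_⟩
  refine hB.imp (fun h z hz => ?_) fun h z hz => ?_
  · exact (congrArg U (h z (BallGeometry.mem_unitBall.1 hz))).trans (hU z)
  · exact (congrArg U (h z (BallGeometry.mem_unitBall.1 hz))).trans (hU _)
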